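/- Let $X$ be a finite simplicial complex. For $i\ge 0$ let $X(i)$ be the set of its $i$-dimensional faces, let $C^i(X)=C^i(X;\mathbb{Z}_2)$ be the space of $\mathbb{Z}_2$-valued functions on $X(i)$, and let $d_i:C^i(X)\to C^{i+1}(X)$ be the usual coboundary operator. For $i=-1$ one may use either the non-reduced convention ($C^{-1}(X)=0$) or the reduced convention ($X(-1)=\{\emptyset\}$, $C^{-1}(X)=\mathbb{Z}_2$, and $d_{-1}$ sends $1$ to the all-ones function on the vertices). For a cochain $\phi\in C^i(X)$ let $\|\phi\|$ be the number of $i$-faces on which $\phi$ is nonzero, and for $\phi\in C^k(X)$, $k\ge 0$, put $$\|\phi\|_{\mathrm{csy}}=\min_{\psi\in C^{k-1}(X)}\|\phi+d_{k-1}\psi\|.$$ The $k$-th Cheeger constant of $X$ is $$h^k(X)=\min\left\{\frac{\|d_k\phi\|}{\|\phi\|_{\mathrm{csy}}}:\ \phi\in C^k(X)\setminus d_{k-1}C^{k-1}(X)\right\}.$$ Let $k\ge 0$ and $D$ be integers and let $X$ be a (non-empty) finite pure $(k+1)$-dimensional simplicial complex, i.e. every face is contained in a $(k+1)$-dimensional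 face and there are no faces of larger dimension. Suppose that every $k$-dimensional face of $X$ is contained in exactly $D$ faces of dimension $k+1$, and that $D\ge 40^2(k+1)$. Then $C^k(X)\setminus d_{k-1}C^{k-1}(X)\neq\emptyset$, so that $h^k(X)$ is defined, and $$h^k(X)\ \le\ \left(1+\frac{50\sqrt{k+1}}{\sqrt{D}}\right)\cdot\frac{D}{k+2}.$$ This holds in both the non-reduced and the reduced convention (they differ only for $k=0$). -/

import Mathlib

namespace CoboundaryExpansion

variable {V : Type*} [Fintype V]

open Classical in
/-- The members of the family `F` with exactly `m` vertices, that is, its `(m - 1)`-dimensional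
faces. -/
noncomputable def cells (F : Set (Finset V)) (m : ℕ) : Finset (Finset V) :=
  Finset.univ.filter fun s => s ∈ F ∧ s.card = m

/-- `𝔽₂`-valued cochains of dimension `m - 1` (functions on the faces with `m` vertices). -/
abbrev Cochain (F : Set (Finset V)) (m : ℕ) : Type _ := cells F m → ZMod 2

open Classical in
/-- The coboundary operator over `𝔽₂` from dimension `m - 1` to dimension `m`: the value at `τ` is
the sum of the values at the facets of `τ`. -/
noncomputable def coboundary (F : Set (Finset V)) (m : ℕ) :
    Cochain F m →ₗ[ZMod 2] Cochain F (m + 1) where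
  toFun φ := fun τ => ∑ σ : cells F m with σ.1 ⊆ τ.1, φ σ
  map_add' φ ψ := by
    funext τ
    simp [Finset.sum_add_distrib]
  map_smul' a φ := by
    funext τ
    simp [Finset.mul_sum]

/-- The norm of a cochain: the size of its support. -/
noncomputable def cnorm {F : Set (Finset V)} {m : ℕ} (φ : Cochain F m) : ℕ :=
  (Function.support φ).ncard

/-- The cosystolic norm of a `k`-cochain `φ` (faces of dimension `k` have `k + 1` vertices):
the minimum of the norms of `φ + d ψ` over all `(k - 1)`-cochains `ψ`. -/
noncomputable def csyNorm {F : Set (Finset V)} {k : ℕ} (φ : Cochain F (k + 1)) : ℕ :=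
  ⨅ ψ : Cochain F k, cnorm (φ + coboundary F k ψ)

/-- The coboundary expansions `‖d φ‖ / ‖φ‖_csy` of all `k`-cochains `φ` that are not
coboundaries. -/
def expansions (F : Set (Finset V)) (k : ℕ) : Set ℝ :=
  {x | ∃ φ : Cochain F (k + 1), φ ∉ LinearMap.range (coboundary F k) ∧
    x = (cnorm (coboundary F (k + 1) φ) : ℝ) / (csyNorm φ : ℝ)}

/-- The `k`-th Cheeger constant of a finite simplicial complex, with non-reduced cochains:
since the empty set is not a member of `X.faces`, there are no nonzero `(-1)`-cochains. -/
noncomputable def cheeger (X : PreAbstractSimplicialComplex V) (k : ℕ) : ℝ :=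
  sInf (expansions X.faces k)

/-- The `k`-th Cheeger constant with reduced (augmented) cochains: the empty simplex is the unique
face of dimension `-1`. It differs from `cheeger X k` only for `k = 0`. -/
noncomputable def reducedCheeger (X : PreAbstractSimplicialComplex V) (k : ℕ) : ℝ :=
  sInf (expansions (insert ∅ X.faces) k)

/-- `X` is nonempty and each of its faces lies in a face of dimension `d`, while no face has larger
dimension. -/
def IsPure (X : PreAbstractSimplicialComplex V) (d : ℕ) : Prop :=
  X.faces.Nonempty ∧ (∀ s ∈ X.faces, s.card ≤ d + 1) ∧
    ∀ s ∈ X.faces, ∃ t ∈ X.faces, s ⊆ t ∧ t.card = d + 1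

/-- The degree of a face: the number of faces with one more vertex that contain it. -/
noncomputable def degree (X : PreAbstractSimplicialComplex V) (s : Finset V) : ℕ :=
  {t ∈ X.faces | s ⊆ t ∧ t.card = s.card + 1}.ncard

end CoboundaryExpansion

namespace CoboundaryExpansion

/-! Probabilistic method. Let p, n, N count the members with k, k + 1, k + 2 vertices, and draw φ
uniformly from C^k. The signs of d φ on distinct faces are orthogonal, so Chebyshev
(`card_sum_sgn_lt_le`) gives ‖d φ‖ ≤ (1 + δ)N/2 with probability at least 1/2. For each of the 2^p
cochains ψ, φ + d ψ is again uniform, so Chernoff (`card_sum_sgn_gt_le`) and a union bound give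
‖φ‖_csy ≥ (1 - ε)n/2 with probability above 1/2. Some φ does both (`exists_cochain`). Double
counting gives nD = N(k + 2) and p/n ≤ (k + 1)/D. Hence there are few enough ψ to take ε = δ = 2√((k
+ 1)/D), and the quotient is at most (1 + δ)/(1 - ε) · D/(k + 2). -/

/-! ### Concentration of sums of signs -/

/-- The nontrivial character of `𝔽₂`, with real values `±1`. -/
def sgn (x : ZMod 2) : ℝ := if x = 0 then 1 else -1

lemma sgn_add (x y : ZMod 2) : sgn (x + y) = sgn x * sgn y := by
  have h : ∀ x y : ZMod 2, (x + y = 0) ↔ (x = 0 ↔ y = 0) := by decide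
  unfold sgn
  by_cases hx : x = 0 <;> by_cases hy : y = 0 <;> simp [h, hx, hy]

lemma sgn_mul_self (x : ZMod 2) : sgn x * sgn x = 1 := by
  unfold sgn; split_ifs <;> norm_num

lemma sgn_of_ne_zero {x : ZMod 2} (hx : x ≠ 0) : sgn x = -1 := if_neg hx

lemma sum_sgn {ι : Type*} [Fintype ι] (φ : ι → ZMod 2) :
    ∑ i, sgn (φ i) = Fintype.card ι - 2 * ((Function.support φ).ncard : ℝ) := by
  classical
  have h : (Function.support φ).ncard = (Finset.univ.filter fun i => φ i ≠ 0).card := by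
    rw [← Set.ncard_coe_finset]; congr 1; ext; simp
  have h' : ∀ i, sgn (φ i) = 1 - 2 * (if φ i ≠ 0 then 1 else 0) := by
    intro i; unfold sgn; by_cases hi : φ i = 0 <;> simp [hi]
    norm_num
  simp only [h', Finset.sum_sub_distrib, ← Finset.mul_sum, h, Finset.sum_boole]
  simp

lemma sum_exp_sum_sgn {ι : Type*} [Fintype ι] [DecidableEq ι] (l : ℝ) :
    ∑ φ : ι → ZMod 2, Real.exp (l * ∑ i, sgn (φ i)) = (2 * Real.cosh l) ^ Fintype.card ι := by
  have h : ∑ x : ZMod 2, Real.exp (l * sgn x) = 2 * Real.cosh l := by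
    rw [show (Finset.univ : Finset (ZMod 2)) = {0, 1} from rfl]
    rw [Finset.sum_pair (by decide), Real.cosh_eq]
    simp [sgn]; ring
  simp only [Finset.mul_sum, Real.exp_sum]
  rw [← Fintype.piFinset_univ, ← Finset.prod_univ_sum (fun _ => Finset.univ)
    (fun _ x => Real.exp (l * sgn x))]
  simp [h]

/-- A Chernoff bound for the volume of a Hamming ball of radius `(1 - ε) n / 2`. -/
lemma card_sum_sgn_gt_le {ι : Type*} [Fintype ι] [DecidableEq ι] (ε : ℝ) (hε : 0 ≤ ε) :
    ((Finset.univ.filter fun φ : ι → ZMod 2 =>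
        ε * Fintype.card ι < ∑ i, sgn (φ i)).card : ℝ) ≤
      2 ^ Fintype.card ι * Real.exp (-(ε ^ 2 * Fintype.card ι / 2)) := by
  set n := Fintype.card ι
  set B := Finset.univ.filter fun φ : ι → ZMod 2 => ε * n < ∑ i, sgn (φ i)
  -- Exponential Markov inequality; the parameter l = ε minimizes the exponent n(l²/2 - lε).
  have h₁ : (B.card : ℝ) * Real.exp (ε * (ε * n)) ≤ (2 * Real.cosh ε) ^ n := by
    rw [← sum_exp_sum_sgn, ← nsmul_eq_mul, ← Finset.sum_const]
    refine (Finset.sum_le_sum fun φ hφ => ?_).trans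
      (Finset.sum_le_sum_of_subset_of_nonneg (Finset.subset_univ B)
        fun φ _ _ => (Real.exp_pos (ε * ∑ i, sgn (φ i))).le)
    have := (Finset.mem_filter.1 hφ).2
    exact Real.exp_le_exp.2 (mul_le_mul_of_nonneg_left this.le hε)
  have h₂ : (2 * Real.cosh ε) ^ n ≤ 2 ^ n * Real.exp (n * (ε ^ 2 / 2)) := by
    rw [mul_pow, Real.exp_nat_mul]
    gcongr
    exact Real.cosh_le_exp_half_sq ε
  refine le_of_mul_le_mul_right ?_ (Real.exp_pos (ε * (ε * n)))
  refine (h₁.trans h₂).trans_eq ?_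
  rw [mul_assoc, ← Real.exp_add]
  congr 2; ring

/-- A linear map whose distinct coordinates are separated has pairwise independent signs. -/
lemma sum_sq_sum_sgn {ι κ : Type*} [Fintype ι] [DecidableEq ι] [Fintype κ] [DecidableEq κ]
    (T : (ι → ZMod 2) →ₗ[ZMod 2] (κ → ZMod 2))
    (hT : ∀ i j, i ≠ j → ∃ φ, T φ i + T φ j ≠ 0) :
    ∑ φ, (∑ j, sgn (T φ j)) ^ 2 = 2 ^ Fintype.card ι * Fintype.card κ := by
  have key : ∀ i j, ∑ φ, sgn (T φ i) * sgn (T φ j) =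
      if i = j then (2 : ℝ) ^ Fintype.card ι else 0 := by
    intro i j
    split_ifs with hij
    · subst hij
      simp [sgn_mul_self]
    · obtain ⟨φ₀, h₀⟩ := hT i j hij
      -- Translation by φ₀ permutes the cochains and flips every summand, so the sum is its own
      -- negative.
      have h := Equiv.sum_comp (Equiv.addRight φ₀) fun φ => sgn (T φ i) * sgn (T φ j)
      simp only [← sgn_add, Equiv.coe_addRight, map_add, Pi.add_apply] at h ⊢
      have h' : ∀ φ, sgn (T φ i + T φ₀ i + (T φ j + T φ₀ j)) = -sgn (T φ i + T φ j) := by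
        intro φ
        rw [add_add_add_comm, sgn_add, sgn_of_ne_zero h₀, mul_neg_one]
      simp only [h', Finset.sum_neg_distrib] at h
      linarith
  simp only [sq, Finset.sum_mul_sum]
  rw [Finset.sum_comm]
  simp_rw [Finset.sum_comm (s := (Finset.univ : Finset (ι → ZMod 2))), key]
  simp [mul_comm]

/-- Chebyshev's inequality for the number of zeros of a random element in the image. -/
lemma card_sum_sgn_lt_le {ι κ : Type*} [Fintype ι] [DecidableEq ι] [Fintype κ] [DecidableEq κ]
    (T : (ι → ZMod 2) →ₗ[ZMod 2] (κ → ZMod 2))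
    (hT : ∀ i j, i ≠ j → ∃ φ, T φ i + T φ j ≠ 0) (δ : ℝ) (hδ : 0 ≤ δ) :
    ((Finset.univ.filter fun φ : ι → ZMod 2 =>
        ∑ j, sgn (T φ j) < -(δ * Fintype.card κ)).card : ℝ) * (δ * Fintype.card κ) ^ 2 ≤
      2 ^ Fintype.card ι * Fintype.card κ := by
  rw [← sum_sq_sum_sgn T hT, ← nsmul_eq_mul, ← Finset.sum_const]
  refine (Finset.sum_le_sum fun φ hφ => ?_).trans
    (Finset.sum_le_sum_of_subset_of_nonneg (Finset.subset_univ _) fun φ _ _ => sq_nonneg _)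
  have := (Finset.mem_filter.1 hφ).2
  have h0 : 0 ≤ δ * Fintype.card κ := by positivity
  nlinarith

/-! ### Random cochains -/

variable {V : Type*} [Fintype V]

lemma mem_cells {F : Set (Finset V)} {m : ℕ} {s : Finset V} :
    s ∈ cells F m ↔ s ∈ F ∧ s.card = m := by
  simp [cells]

open Classical in
lemma coboundary_single {F : Set (Finset V)} {m : ℕ} (σ : cells F m) (τ : cells F (m + 1)) :
    coboundary F m (Pi.single σ 1) τ = if σ.1 ⊆ τ.1 then 1 else 0 := by
  change ∑ ρ : cells F m with ρ.1 ⊆ τ.1, (Pi.single σ 1 : Cochain F m) ρ = _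
  simp [Pi.single_apply, Finset.sum_ite_eq']

/-- Faces of equal size are not nested, so an m-subset of τ through a vertex outside τ' has an
indicator cochain separating the two. The bound 1 ≤ m leaves room for that vertex. -/
lemma exists_coboundary_add_ne_zero {F : Set (Finset V)} {m : ℕ} (hm : 1 ≤ m)
    (hF : ∀ t ∈ F, ∀ s ⊆ t, s.Nonempty → s ∈ F) (τ τ' : cells F (m + 1)) (hne : τ ≠ τ') :
    ∃ φ, coboundary F m φ τ + coboundary F m φ τ' ≠ 0 := by
  classical
  obtain ⟨hτ, hc⟩ := mem_cells.1 τ.2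
  obtain ⟨-, hc'⟩ := mem_cells.1 τ'.2
  have hns : ¬ τ.1 ⊆ τ'.1 := fun h =>
    hne (Subtype.ext (Finset.eq_of_subset_of_card_le h (by omega)))
  obtain ⟨v, hv, hv'⟩ := Finset.not_subset.1 hns
  obtain ⟨σ, hvσ, hστ, hσ⟩ := Finset.exists_subsuperset_card_eq
    (Finset.singleton_subset_iff.2 hv) (n := m) (by simpa using hm) (by omega)
  rw [Finset.singleton_subset_iff] at hvσ
  have hσF : σ ∈ cells F m := mem_cells.2 ⟨hF _ hτ _ hστ ⟨v, hvσ⟩, hσ⟩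
  refine ⟨Pi.single ⟨σ, hσF⟩ 1, ?_⟩
  rw [coboundary_single, coboundary_single, if_pos hστ, if_neg fun h => hv' (h hvσ)]
  simp

lemma cnorm_eq {F : Set (Finset V)} {m : ℕ} (φ : Cochain F m) :
    (cnorm φ : ℝ) = ((cells F m).card - ∑ σ, sgn (φ σ)) / 2 := by
  rw [sum_sgn, Fintype.card_coe, cnorm]; ring

/-- A random cochain has small coboundary and large cosystolic norm. -/
lemma exists_cochain {F : Set (Finset V)} {k : ℕ} {ε δ : ℝ} (hε : 0 ≤ ε) (hδ : 0 ≤ δ)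
    (hF : ∀ t ∈ F, ∀ s ⊆ t, s.Nonempty → s ∈ F)
    (h₁ : (2 : ℝ) ^ (cells F k).card * Real.exp (-(ε ^ 2 * (cells F (k + 1)).card / 2)) < 1 / 2)
    (h₂ : 2 ≤ δ ^ 2 * (cells F (k + 2)).card) :
    ∃ φ : Cochain F (k + 1),
      (cnorm (coboundary F (k + 1) φ) : ℝ) ≤ (1 + δ) * (cells F (k + 2)).card / 2 ∧
      (1 - ε) * (cells F (k + 1)).card / 2 ≤ csyNorm φ := by
  classical
  set p := (cells F k).card
  set n := (cells F (k + 1)).card with hn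
  set N := (cells F (k + 2)).card with hN
  set A : Finset (Cochain F (k + 1)) :=
    Finset.univ.filter fun φ => ε * n < ∑ i, sgn (φ i) with hA
  set B : Finset (Cochain F (k + 1)) :=
    Finset.univ.filter fun φ => ∑ j, sgn (coboundary F (k + 1) φ j) < -(δ * N) with hB
  have hAcard : (A.card : ℝ) ≤ 2 ^ n * Real.exp (-(ε ^ 2 * n / 2)) := by
    simpa only [Fintype.card_coe] using card_sum_sgn_gt_le (ι := cells F (k + 1)) ε hε
  have hBcard : (B.card : ℝ) * (δ * N) ^ 2 ≤ 2 ^ n * N := by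
    simpa only [Fintype.card_coe] using card_sum_sgn_lt_le (coboundary F (k + 1))
      (exists_coboundary_add_ne_zero (Nat.succ_pos k) hF) δ hδ
  have hN0 : (0 : ℝ) < N := by
    rcases (Nat.cast_nonneg N : (0 : ℝ) ≤ N).eq_or_lt with h | h
    · rw [← h] at h₂; norm_num at h₂
    · exact h
  have hBcard' : (B.card : ℝ) ≤ 2 ^ n / 2 := by
    have h : (B.card : ℝ) * (δ ^ 2 * N) ≤ 2 ^ n := by
      refine le_of_mul_le_mul_right ?_ hN0
      linarith [show (B.card : ℝ) * (δ * N) ^ 2 = B.card * (δ ^ 2 * N) * N by ring]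
    have := mul_le_mul_of_nonneg_left h₂ (Nat.cast_nonneg (α := ℝ) B.card)
    linarith
  -- The φ for which some φ + d ψ lies in `A`: a union of 2^p translates of `A`.
  set U : Finset (Cochain F (k + 1)) :=
    Finset.univ.biUnion fun ψ : Cochain F k => A.image fun φ => φ - coboundary F k ψ
  have hUcard : (U.card : ℝ) < 2 ^ n / 2 := by
    have h : U.card ≤ 2 ^ p * A.card := by
      refine (Finset.card_biUnion_le_card_mul _ _ _ fun ψ _ => Finset.card_image_le).trans_eq ?_
      simp [p]
    have h' : (U.card : ℝ) ≤ 2 ^ p * A.card := by exact_mod_cast h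
    calc (U.card : ℝ) ≤ 2 ^ p * (2 ^ n * Real.exp (-(ε ^ 2 * n / 2))) :=
          h'.trans (mul_le_mul_of_nonneg_left hAcard (by positivity))
      _ = 2 ^ n * (2 ^ p * Real.exp (-(ε ^ 2 * n / 2))) := by ring
      _ < 2 ^ n * (1 / 2) := mul_lt_mul_of_pos_left h₁ (by positivity)
      _ = 2 ^ n / 2 := by ring
  have hcard : (U ∪ B).card < (Finset.univ : Finset (Cochain F (k + 1))).card := by
    have h : ((U ∪ B).card : ℝ) < 2 ^ n := by
      have : ((U ∪ B).card : ℝ) ≤ U.card + B.card := by exact_mod_cast Finset.card_union_le U B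
      linarith
    have h' : (Finset.univ : Finset (Cochain F (k + 1))).card = 2 ^ n := by simp [hn]
    rw [h']
    exact_mod_cast h
  obtain ⟨φ, -, hφ⟩ := Finset.exists_mem_notMem_of_card_lt_card hcard
  rw [Finset.mem_union, not_or] at hφ
  refine ⟨φ, ?_, ?_⟩
  · have h := hφ.2
    simp only [hB, Finset.mem_filter, Finset.mem_univ, true_and, not_lt] at h
    rw [cnorm_eq]
    linarith
  · obtain ⟨ψ, hψ⟩ := ciInf_mem fun ψ : Cochain F k => cnorm (φ + coboundary F k ψ)
    rw [csyNorm, ← hψ]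
    have h : φ + coboundary F k ψ ∉ A := fun h => hφ.1 <|
      Finset.mem_biUnion.2 ⟨ψ, Finset.mem_univ _,
        Finset.mem_image.2 ⟨_, h, add_sub_cancel_right _ _⟩⟩
    simp only [hA, Finset.mem_filter, Finset.mem_univ, true_and, not_lt] at h
    simp only [cnorm_eq]
    linarith

/-- Used contrapositively: a positive cosystolic norm certifies that the random φ is not a
coboundary. -/
lemma csyNorm_eq_zero {F : Set (Finset V)} {k : ℕ} {φ : Cochain F (k + 1)}
    (hφ : φ ∈ LinearMap.range (coboundary F k)) : csyNorm φ = 0 := by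
  obtain ⟨ψ, rfl⟩ := hφ
  refine Nat.le_zero.1 ((ciInf_le (OrderBot.bddBelow _) (-ψ)).trans_eq ?_)
  simp [cnorm]

lemma expansions_bddBelow (F : Set (Finset V)) (k : ℕ) : BddBelow (expansions F k) :=
  ⟨0, by rintro _ ⟨φ, -, rfl⟩; positivity⟩

/-! ### Choice of constants -/

/-- The upper bound on the Cheeger constant, in terms of face numbers. -/
lemma sInf_expansions_le {F : Set (Finset V)} {k D : ℕ}
    (hF : ∀ t ∈ F, ∀ s ⊆ t, s.Nonempty → s ∈ F) (hD : 40 ^ 2 * (k + 1) ≤ D)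
    (hN : (cells F (k + 1)).card * D = (cells F (k + 2)).card * (k + 2))
    (hp : (cells F k).card * D ≤ (cells F (k + 1)).card * (k + 1))
    (hn : D ≤ (cells F (k + 1)).card) :
    (expansions F k).Nonempty ∧ sInf (expansions F k) ≤
      (1 + 50 * √((k : ℝ) + 1) / √(D : ℝ)) * ((D : ℝ) / ((k : ℝ) + 2)) := by
  set s : ℝ := √((k : ℝ) + 1) / √(D : ℝ) with hs
  have hk0 : (0 : ℝ) ≤ k := Nat.cast_nonneg k
  have hDr : (1600 : ℝ) * (k + 1) ≤ D := by exact_mod_cast hD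
  have hD0 : (0 : ℝ) < D := by linarith
  have hs0 : 0 ≤ s := by positivity
  have hs2 : s ^ 2 * D = k + 1 := by
    rw [hs, div_pow, Real.sq_sqrt (by positivity), Real.sq_sqrt hD0.le]
    field_simp
  have hs40 : s ≤ 1 / 40 := by
    have : s ^ 2 ≤ (1 / 40) ^ 2 := by nlinarith
    exact le_of_sq_le_sq this (by norm_num)
  set p : ℝ := ((cells F k).card : ℝ) with hpdef
  set n : ℝ := ((cells F (k + 1)).card : ℝ) with hndef
  set N : ℝ := ((cells F (k + 2)).card : ℝ) with hNdef
  have hN' : n * D = N * (k + 2) := by rw [hndef, hNdef]; exact_mod_cast hN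
  have hp' : p * D ≤ n * (k + 1) := by rw [hpdef, hndef]; exact_mod_cast hp
  have hn' : (D : ℝ) ≤ n := by rw [hndef]; exact_mod_cast hn
  have hn0 : 0 < n := hD0.trans_le hn'
  have hps : p ≤ s ^ 2 * n := by
    refine le_of_mul_le_mul_right ?_ hD0
    calc p * D ≤ n * (k + 1) := hp'
      _ = s ^ 2 * n * D := by rw [← hs2]; ring
  have hns : 1 ≤ s ^ 2 * n := by nlinarith [sq_nonneg s]
  have h₁ : (2 : ℝ) ^ (cells F k).card * Real.exp (-((2 * s) ^ 2 * n / 2)) < 1 / 2 := by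
    rw [← Real.exp_log (show (0 : ℝ) < 2 ^ (cells F k).card by positivity), Real.log_pow,
      ← Real.exp_add, ← hpdef]
    -- The exponent is at most s²n(log 2 - 2) ≤ -1, as p ≤ s²n, s²n ≥ 1 and log 2 < 1.
    refine lt_of_le_of_lt (Real.exp_le_exp.2 ?_) Real.exp_neg_one_lt_half
    have := Real.log_two_lt_d9
    have hp0 : 0 ≤ p := Nat.cast_nonneg _
    nlinarith
  have h₂ : 2 ≤ (2 * s) ^ 2 * N := by
    have h : s ^ 2 * N * (k + 2) = n * (k + 1) := by
      rw [mul_assoc, ← hN', ← hs2]; ring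
    have : (1 : ℝ) / 2 * (k + 2) ≤ s ^ 2 * N * (k + 2) := by
      rw [h]; nlinarith
    have := le_of_mul_le_mul_right this (by linarith)
    linarith
  obtain ⟨φ, hd, hc⟩ := exists_cochain (by positivity : 0 ≤ 2 * s) (by positivity : 0 ≤ 2 * s)
    hF h₁ h₂
  rw [← hNdef] at hd
  rw [← hndef] at hc
  have hc0 : 0 < (1 - 2 * s) * n / 2 := by
    have : 0 < 1 - 2 * s := by linarith
    positivity
  have hmem : (cnorm (coboundary F (k + 1) φ) : ℝ) / (csyNorm φ : ℝ) ∈ expansions F k := by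
    refine ⟨φ, fun h => ?_, rfl⟩
    rw [csyNorm_eq_zero h, Nat.cast_zero] at hc
    linarith
  refine ⟨⟨_, hmem⟩, (csInf_le (expansions_bddBelow F k) hmem).trans ?_⟩
  have hND : N = n * (D / (k + 2)) := by field_simp; linarith
  rw [div_le_iff₀ (hc0.trans_le hc), mul_div_assoc, ← hs]
  have hq : 0 ≤ (D : ℝ) / (k + 2) := by positivity
  calc (cnorm (coboundary F (k + 1) φ) : ℝ) ≤ (1 + 2 * s) * N / 2 := hd
    _ = (1 + 2 * s) * (n * (D / (k + 2)) / 2) := by rw [hND]; ring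
    _ ≤ (1 + 50 * s) * (1 - 2 * s) * (n * (D / (k + 2)) / 2) := by
      refine mul_le_mul_of_nonneg_right ?_ (by positivity)
      nlinarith
    _ = (1 + 50 * s) * (D / (k + 2)) * ((1 - 2 * s) * n / 2) := by ring
    _ ≤ _ := mul_le_mul_of_nonneg_left hc (by positivity)

/-! ### Face counting and the two conventions -/

open Classical in
/-- A family that is closed under nonempty subsets, regular in codimension one, and such that each
member with `k` vertices extends to one with `k + 1` vertices, satisfies the Cheeger bound. -/
lemma sInf_expansions_le_of_regular {F : Set (Finset V)} {k D : ℕ}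
    (hF : ∀ t ∈ F, ∀ s ⊆ t, s.Nonempty → s ∈ F) (hD : 40 ^ 2 * (k + 1) ≤ D)
    (hne : ∃ u ∈ F, u.card = k + 1)
    (hext : ∀ s ∈ F, s.card = k → ∃ u ∈ F, s ⊆ u ∧ u.card = k + 1)
    (hdeg : ∀ u ∈ F, u.card = k + 1 → ((cells F (k + 2)).filter (u ⊆ ·)).card = D) :
    (expansions F k).Nonempty ∧ sInf (expansions F k) ≤
      (1 + 50 * √((k : ℝ) + 1) / √(D : ℝ)) * ((D : ℝ) / ((k : ℝ) + 2)) := by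
  have hlow : ∀ u ∈ F, u.card = k + 1 → ∀ s ⊆ u, s.card = k →
      D ≤ ((cells F (k + 1)).filter (s ⊆ ·)).card := by
    intro u hu huc s hsu hsc
    rw [← hdeg u hu huc]
    -- Adding to s the vertex by which t extends u loses nothing: the union of the image with u is
    -- t.
    refine Finset.card_le_card_of_injOn (fun t => s ∪ (t \ u)) ?_ ?_
    · intro t ht
      simp only [Finset.coe_filter, mem_cells, Set.mem_ofPred_eq] at ht ⊢
      obtain ⟨⟨htF, htc⟩, hut⟩ := ht
      have hdisj : Disjoint s (t \ u) := Finset.disjoint_sdiff.mono_left hsu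
      have hcard : (s ∪ (t \ u)).card = k + 1 := by
        rw [Finset.card_union_of_disjoint hdisj, Finset.card_sdiff_of_subset hut]; omega
      refine ⟨⟨hF t htF _ (Finset.union_subset (hsu.trans hut) Finset.sdiff_subset) ?_, hcard⟩,
        Finset.subset_union_left⟩
      exact Finset.card_pos.1 (by omega)
    · intro t ht t' ht' h
      simp only [Finset.coe_filter, mem_cells, Set.mem_ofPred_eq] at ht ht'
      have h' := congrArg (u ∪ ·) h
      simp only [← Finset.union_assoc, Finset.union_eq_left.2 hsu] at h'
      rwa [Finset.union_sdiff_of_subset ht.2, Finset.union_sdiff_of_subset ht'.2] at h'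
  refine sInf_expansions_le hF hD ?_ ?_ ?_
  · refine Finset.card_mul_eq_card_mul (· ⊆ ·) (fun u hu => ?_) fun t ht => ?_
    · exact hdeg u (mem_cells.1 hu).1 (mem_cells.1 hu).2
    · have h : (cells F (k + 1)).bipartiteBelow (· ⊆ ·) t = t.powersetCard (k + 1) := by
        ext u
        simp only [Finset.mem_bipartiteBelow, mem_cells, Finset.mem_powersetCard]
        refine ⟨fun h => ⟨h.2, h.1.2⟩, fun h => ⟨⟨hF t (mem_cells.1 ht).1 u h.1 ?_, h.2⟩, h.1⟩⟩
        exact Finset.card_pos.1 (by omega)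
      rw [h, Finset.card_powersetCard, (mem_cells.1 ht).2]
      exact Nat.choose_succ_self_right (k + 1)
  · refine Finset.card_mul_le_card_mul (· ⊆ ·) (fun s hs => ?_) fun u hu => ?_
    · obtain ⟨u, hu, hsu, huc⟩ := hext s (mem_cells.1 hs).1 (mem_cells.1 hs).2
      exact hlow u hu huc s hsu (mem_cells.1 hs).2
    -- Only an inclusion: when k = 0, the empty set may be missing from F.
    · have h : (cells F k).bipartiteBelow (· ⊆ ·) u ⊆ u.powersetCard k := by
        intro s
        simp only [Finset.mem_bipartiteBelow, mem_cells, Finset.mem_powersetCard]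
        exact fun h => ⟨h.2, h.1.2⟩
      refine (Finset.card_le_card h).trans_eq ?_
      rw [Finset.card_powersetCard, (mem_cells.1 hu).2]
      exact Nat.choose_succ_self_right k
  · obtain ⟨u, hu, huc⟩ := hne
    obtain ⟨s, hsu, hsc⟩ := Finset.exists_subset_card_eq (s := u) (n := k) (by omega)
    exact (hlow u hu huc s hsu hsc).trans (Finset.card_le_card (Finset.filter_subset _ _))

open Classical in
lemma card_filter_cells_eq_degree (X : PreAbstractSimplicialComplex V) {F : Set (Finset V)} {k : ℕ}
    (hFX : ∀ s : Finset V, s.Nonempty → (s ∈ F ↔ s ∈ X.faces)) {u : Finset V}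
    (hu : u.card = k + 1) : ((cells F (k + 2)).filter (u ⊆ ·)).card = degree X u := by
  rw [degree, ← Set.ncard_coe_finset]
  congr 1
  ext t
  simp only [Finset.coe_filter, mem_cells, Set.mem_ofPred_eq, hu]
  constructor
  · rintro ⟨⟨ht, htc⟩, hut⟩
    exact ⟨(hFX t (Finset.card_pos.1 (by omega))).1 ht, hut, htc⟩
  · rintro ⟨ht, hut, htc⟩
    exact ⟨⟨(hFX t (Finset.card_pos.1 (by omega))).2 ht, htc⟩, hut⟩

/-- The Cheeger bound for any family whose nonempty members are the faces of a regular pure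
complex. -/
lemma sInf_expansions_le_of_isPure {X : PreAbstractSimplicialComplex V} {k D : ℕ}
    (hpure : IsPure X (k + 1)) (hdeg : ∀ s ∈ X.faces, s.card = k + 1 → degree X s = D)
    (hD : 40 ^ 2 * (k + 1) ≤ D) {F : Set (Finset V)}
    (hFX : ∀ s : Finset V, s.Nonempty → (s ∈ F ↔ s ∈ X.faces)) :
    (expansions F k).Nonempty ∧ sInf (expansions F k) ≤
      (1 + 50 * √((k : ℝ) + 1) / √(D : ℝ)) * ((D : ℝ) / ((k : ℝ) + 2)) := by
  obtain ⟨⟨s₀, hs₀⟩, -, hp⟩ := hpure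
  have hX : ∀ t ∈ X.faces, ∀ s ⊆ t, s.Nonempty → s ∈ X.faces := fun t ht s hst hs =>
    (X.isRelLowerSet_faces ht).2 hst hs
  have hF : ∀ t ∈ F, ∀ s ⊆ t, s.Nonempty → s ∈ F := fun t ht s hst hs =>
    (hFX s hs).2 (hX t ((hFX t (hs.mono hst)).1 ht) s hst hs)
  have hsub : ∀ s t : Finset V, t ∈ X.faces → s ⊆ t → t.card = k + 1 + 1 → s.card ≤ k + 1 →
      ∃ u ∈ F, s ⊆ u ∧ u.card = k + 1 := by
    intro s t ht hst htc hsc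
    obtain ⟨u, hsu, hut, huc⟩ := Finset.exists_subsuperset_card_eq hst (n := k + 1) hsc (by omega)
    have hune : u.Nonempty := Finset.card_pos.1 (by omega)
    exact ⟨u, (hFX u hune).2 (hX t ht u hut hune), hsu, huc⟩
  obtain ⟨t₀, ht₀, -, htc₀⟩ := hp s₀ hs₀
  refine sInf_expansions_le_of_regular hF hD ?_ ?_ ?_
  · obtain ⟨u, hu, -, huc⟩ := hsub ∅ t₀ ht₀ (Finset.empty_subset _) htc₀ (by simp)
    exact ⟨u, hu, huc⟩
  · intro s hs hsc
    -- In the reduced convention with k = 0, s = ∅ is not a face of X, so purity does not apply to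
    -- it.
    rcases s.eq_empty_or_nonempty with rfl | hne
    · exact hsub ∅ t₀ ht₀ (Finset.empty_subset _) htc₀ (by simp)
    · obtain ⟨t, ht, hst, htc⟩ := hp s ((hFX s hne).1 hs)
      exact hsub s t ht hst htc (by omega)
  · intro u hu huc
    rw [card_filter_cells_eq_degree X hFX huc]
    exact hdeg u ((hFX u (Finset.card_pos.1 (by omega))).1 hu) huc

end CoboundaryExpansion

theorem theoremt {V : Type*} [Fintype V] (X : PreAbstractSimplicialComplex V) (k D : ℕ)
    (hpure : CoboundaryExpansion.IsPure X (k + 1))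
    (hdeg : ∀ s ∈ X.faces, s.card = k + 1 → CoboundaryExpansion.degree X s = D)
    (hD : 40 ^ 2 * (k + 1) ≤ D) :
    ((CoboundaryExpansion.expansions X.faces k).Nonempty ∧
      CoboundaryExpansion.cheeger X k ≤
        (1 + 50 * √((k : ℝ) + 1) / √(D : ℝ)) * ((D : ℝ) / ((k : ℝ) + 2))) ∧
    ((CoboundaryExpansion.expansions (insert ∅ X.faces) k).Nonempty ∧
      CoboundaryExpansion.reducedCheeger X k ≤
        (1 + 50 * √((k : ℝ) + 1) / √(D : ℝ)) * ((D : ℝ) / ((k : ℝ) + 2))) := by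
  refine ⟨CoboundaryExpansion.sInf_expansions_le_of_isPure hpure hdeg hD fun _ _ => Iff.rfl,
    CoboundaryExpansion.sInf_expansions_le_of_isPure hpure hdeg hD fun s hs => ?_⟩
  simp [hs.ne_empty]
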